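/- A $3$-graph $H=(V,E)$ consists of a finite vertex set $V$ and a set $E$ of $3$-element subsets of $V$, called edges. Its connected components are the classes of the equivalence relation on $V$ generated by "lying in a common edge" (an isolated vertex is a component by itself). For integers $n>k\ge 3$ let $T(n,K_k^{(3)})$ be the smallest number of edges of a $3$-graph on $n$ vertices in which every $k$-element set of vertices contains at least one edge, and for $m\ge 1$ let $T(n,K_k^{(3)};m)$ be the smallest number of edges of such a $3$-graph that has exactly $m$ connected components. Put $$t_{3,k}:=\lim_{n\to\infty}\frac{T(n,K_k^{(3)})}{\binom n3},\qquad t_{3,k}(m):=\lim_{n\to\infty}\frac{T(n,K_k^{(3)};m)}{\binom n3}.$$ Theorem. The limit $t_{3,4}$ exists and is positive, and for every integer $m\ge 1$ the limits $t_{3,2m+1}(m)$ and $t_{3,2m+2}(m)$ exist and satisfy $$t_{3,2m+1}(m)=\frac1{m^2},\qquad t_{3,2m+2}(m)=\left(m-1+t_{3,4}^{-1/2}\right)^{-2}.$$ -/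

import Mathlib

open Filter Topology

/-- An `r`-uniform hypergraph (an `r`-graph) on the vertex set `V`:
a set of `r`-element subsets of `V`, called edges. -/
@[ext]
structure RGraph (r : ℕ) (V : Type*) where
  edges : Finset (Finset V)
  uniform : ∀ e ∈ edges, e.card = r

namespace RGraph

variable {r : ℕ} {V : Type*}

/-- The graph in which two distinct vertices are adjacent when some edge of `H` contains both.
Its walks are exactly the vertex sequences of walks in the hypergraph `H`. -/
def shadow (H : RGraph r V) : SimpleGraph V where
  Adj u v := u ≠ v ∧ ∃ e ∈ H.edges, u ∈ e ∧ v ∈ e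
  symm := ⟨fun _ _ ⟨hne, e, he, hu, hv⟩ => ⟨hne.symm, e, he, hv, hu⟩⟩
  loopless := ⟨fun _ h => h.1 rfl⟩

/-- The number of connected components of the hypergraph `H`; an isolated vertex is a component. -/
noncomputable def numComponents (H : RGraph r V) : ℕ :=
  Nat.card H.shadow.ConnectedComponent

/-- Every `k`-element set of vertices contains at least one edge of `H`. -/
def Covers (H : RGraph r V) (k : ℕ) : Prop :=
  ∀ S : Finset V, S.card = k → ∃ e ∈ H.edges, e ⊆ S

end RGraph

/-- The dual Turán number `T(n, K_k^{(r)})`: the least number of edges of an `r`-graph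
on `n` vertices in which every `k`-set of vertices contains an edge. -/
noncomputable def dualTuran (n k r : ℕ) : ℕ :=
  sInf {t : ℕ | ∃ H : RGraph r (Fin n), H.edges.card = t ∧ H.Covers k}

/-- `T(n, K_k^{(r)}; m)`: the least number of edges of an `r`-graph on `n` vertices
with exactly `m` connected components in which every `k`-set of vertices contains an edge. -/
noncomputable def dualTuranComp (n k r m : ℕ) : ℕ :=
  sInf {t : ℕ | ∃ H : RGraph r (Fin n),
    H.edges.card = t ∧ H.numComponents = m ∧ H.Covers k}

/-- The density `T(n, K_k^{(r)}) / binom(n, r)`. -/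
noncomputable def dualTuranRatio (r k n : ℕ) : ℝ :=
  (dualTuran n k r : ℝ) / (n.choose r : ℝ)

/-- The density `T(n, K_k^{(r)}; m) / binom(n, r)`. -/
noncomputable def dualTuranCompRatio (r k m n : ℕ) : ℝ :=
  (dualTuranComp n k r m : ℝ) / (n.choose r : ℝ)

/-- The limit density `t_{r,k}`. -/
noncomputable def turanLimit (r k : ℕ) : ℝ :=
  limUnder atTop (dualTuranRatio r k)

/-- The limit density `t_{r,k}(m)`. -/
noncomputable def turanCompLimit (r k m : ℕ) : ℝ :=
  limUnder atTop (dualTuranCompRatio r k m)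

namespace RGraph

/-- The pullback of an `r`-graph along an embedding. -/
noncomputable def comap {r : ℕ} {V W : Type*} (H : RGraph r W) (f : V ↪ W) : RGraph r V where
  edges := H.edges.preimage (Finset.map f) (Finset.map_injective f).injOn
  uniform e he := by
    have := H.uniform _ (Finset.mem_preimage.1 he)
    rwa [Finset.card_map] at this

theorem mem_comap_edges {r : ℕ} {V W : Type*} {H : RGraph r W} {f : V ↪ W} {e : Finset V} :
    e ∈ (H.comap f).edges ↔ e.map f ∈ H.edges := by simp [comap]

/-- The complete `r`-graph. -/
def complete (r : ℕ) (V : Type*) [Fintype V] : RGraph r V where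
  edges := Finset.univ.powersetCard r
  uniform _ he := (Finset.mem_powersetCard.1 he).2

theorem mem_complete_edges {r : ℕ} {V : Type*} [Fintype V] {e : Finset V} :
    e ∈ (complete r V).edges ↔ e.card = r := by
  simp [complete, Finset.mem_powersetCard]

theorem card_complete_edges (r : ℕ) (V : Type*) [Fintype V] :
    (complete r V).edges.card = (Fintype.card V).choose r := by
  simp [complete, Finset.card_powersetCard]

theorem complete_covers {r k : ℕ} (hk : r ≤ k) (V : Type*) [Fintype V] :
    (complete r V).Covers k := by
  intro S hS
  obtain ⟨e, he, hc⟩ := Finset.exists_subset_card_eq (hS ▸ hk : r ≤ S.card)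
  exact ⟨e, mem_complete_edges.2 hc, he⟩

end RGraph

theorem exists_card_eq_dualTuran {r k : ℕ} (hk : r ≤ k) (n : ℕ) :
    ∃ H : RGraph r (Fin n), H.edges.card = dualTuran n k r ∧ H.Covers k :=
  Nat.sInf_mem (s := {t : ℕ | ∃ H : RGraph r (Fin n), H.edges.card = t ∧ H.Covers k})
    ⟨_, RGraph.complete r _, rfl, RGraph.complete_covers hk _⟩

theorem dualTuran_le_choose {r k : ℕ} (hk : r ≤ k) (n : ℕ) : dualTuran n k r ≤ n.choose r :=
  Nat.sInf_le ⟨RGraph.complete r _, by simp [RGraph.card_complete_edges],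
    RGraph.complete_covers hk _⟩

/-- An `r`-graph whose restriction to `S` covers all `k`-sets has at least
`T(|S|, K_k^{(r)})` edges inside `S`. -/
theorem dualTuran_card_le {r k : ℕ} {V : Type*} [DecidableEq V] (H : RGraph r V) (S : Finset V)
    (hS : ∀ A ⊆ S, A.card = k → ∃ e ∈ H.edges, e ⊆ A) :
    dualTuran S.card k r ≤ (H.edges.filter (· ⊆ S)).card := by
  let f : Fin S.card ↪ V := S.equivFin.symm.toEmbedding.trans (Function.Embedding.subtype _)
  have hf : ∀ A : Finset (Fin S.card), A.map f ⊆ S := by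
    intro A x hx
    obtain ⟨y, -, rfl⟩ := Finset.mem_map.1 hx
    exact (S.equivFin.symm y).2
  have hf' : ∀ x ∈ S, ∃ y, f y = x := fun x hx => ⟨S.equivFin ⟨x, hx⟩, by simp [f]⟩
  calc dualTuran S.card k r ≤ (H.comap f).edges.card := by
        refine Nat.sInf_le ⟨H.comap f, rfl, fun A hA => ?_⟩
        obtain ⟨e, he, heA⟩ := hS (A.map f) (hf A) (by simpa using hA)
        obtain ⟨e', he', rfl⟩ := Finset.subset_map_iff.1 heA
        exact ⟨e', RGraph.mem_comap_edges.2 he, he'⟩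
    _ ≤ _ := by
        refine Finset.card_le_card_of_injOn (Finset.map f) (fun e he => ?_)
          (Finset.map_injective f).injOn
        rw [Finset.mem_coe, RGraph.mem_comap_edges] at he
        simp only [Finset.coe_filter, Set.mem_ofPred_eq]
        exact ⟨he, hf e⟩

theorem succ_mul_dualTuran_le {r k : ℕ} (hk : r ≤ k) (n : ℕ) :
    (n + 1) * dualTuran n k r ≤ (n + 1 - r) * dualTuran (n + 1) k r := by
  obtain ⟨H, hH, hc⟩ := exists_card_eq_dualTuran hk (n + 1)
  have h1 : ∀ v : Fin (n + 1), dualTuran n k r ≤ (H.edges.filter (fun e => v ∉ e)).card := by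
    intro v
    have := dualTuran_card_le H (Finset.univ.erase v) (fun A _ hA => hc A hA)
    simp only [Finset.mem_univ, Finset.card_erase_of_mem, Finset.card_univ, Fintype.card_fin,
      Nat.add_sub_cancel] at this
    refine this.trans (Finset.card_le_card ?_)
    intro e he
    simp only [Finset.mem_filter] at he ⊢
    exact ⟨he.1, fun hv => by simpa using he.2 hv⟩
  calc (n + 1) * dualTuran n k r = ∑ v : Fin (n + 1), dualTuran n k r := by simp
    _ ≤ ∑ v : Fin (n + 1), (H.edges.filter (fun e => v ∉ e)).card :=
        Finset.sum_le_sum fun v _ => h1 v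
    _ = ∑ e ∈ H.edges, (Finset.univ.filter (fun v => v ∉ e)).card :=
        Finset.sum_card_bipartiteAbove_eq_sum_card_bipartiteBelow (fun v e => v ∉ e)
    _ = ∑ e ∈ H.edges, (n + 1 - r) := by
        refine Finset.sum_congr rfl fun e he => ?_
        have : (Finset.univ.filter (fun v => v ∉ e)) = eᶜ := by ext; simp
        rw [this, Finset.card_compl, H.uniform e he, Fintype.card_fin]
    _ = _ := by rw [Finset.sum_const, smul_eq_mul, hH, mul_comm]

theorem dualTuranRatio_nonneg (r k n : ℕ) : 0 ≤ dualTuranRatio r k n := by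
  unfold dualTuranRatio; positivity

theorem dualTuranRatio_le_one {r k : ℕ} (hk : r ≤ k) (n : ℕ) : dualTuranRatio r k n ≤ 1 :=
  div_le_one_of_le₀ (by exact_mod_cast dualTuran_le_choose hk n) (by positivity)

theorem monotone_dualTuranRatio {r k : ℕ} (hk : r ≤ k) : Monotone (dualTuranRatio r k) := by
  refine monotone_nat_of_le_succ fun n => ?_
  rcases lt_or_ge n r with h | h
  · rw [dualTuranRatio, Nat.choose_eq_zero_of_lt h]
    simpa using dualTuranRatio_nonneg r k (n + 1)
  · have p1 := Nat.choose_pos h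
    have p2 := Nat.choose_pos (h.trans n.le_succ)
    unfold dualTuranRatio
    rw [div_le_div_iff₀ (by exact_mod_cast p1) (by exact_mod_cast p2)]
    norm_cast
    refine Nat.le_of_mul_le_mul_left ?_ n.succ_pos
    rw [Nat.succ_eq_add_one]
    calc (n + 1) * (dualTuran n k r * (n + 1).choose r)
        = (n + 1) * dualTuran n k r * (n + 1).choose r := by ring
      _ ≤ (n + 1 - r) * dualTuran (n + 1) k r * (n + 1).choose r :=
          Nat.mul_le_mul_right _ (succ_mul_dualTuran_le hk n)
      _ = dualTuran (n + 1) k r * ((n + 1).choose r * (n + 1 - r)) := by ring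
      _ = _ := by rw [← Nat.choose_mul_succ_eq]; ring

theorem tendsto_dualTuranRatio {r k : ℕ} (hk : r ≤ k) :
    Tendsto (dualTuranRatio r k) atTop (𝓝 (turanLimit r k)) := by
  have h := tendsto_atTop_ciSup (monotone_dualTuranRatio hk)
    ⟨1, by rintro _ ⟨n, rfl⟩; exact dualTuranRatio_le_one hk n⟩
  rwa [turanLimit, h.limUnder_eq]

theorem dualTuranRatio_le_turanLimit {r k : ℕ} (hk : r ≤ k) (n : ℕ) :
    dualTuranRatio r k n ≤ turanLimit r k :=
  (monotone_dualTuranRatio hk).ge_of_tendsto (tendsto_dualTuranRatio hk) n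

theorem dualTuran_le_turanLimit_mul {r k : ℕ} (hk : r ≤ k) (n : ℕ) :
    (dualTuran n k r : ℝ) ≤ turanLimit r k * n.choose r := by
  rcases lt_or_ge n r with h | h
  · have := dualTuran_le_choose hk n
    rw [Nat.choose_eq_zero_of_lt h] at this
    simp [Nat.choose_eq_zero_of_lt h, Nat.le_zero.1 this]
  · exact (div_le_iff₀ (by exact_mod_cast Nat.choose_pos h)).1 (dualTuranRatio_le_turanLimit hk n)

theorem turanLimit_le_one {r k : ℕ} (hk : r ≤ k) : turanLimit r k ≤ 1 :=
  le_of_tendsto' (tendsto_dualTuranRatio hk) (dualTuranRatio_le_one hk)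
namespace RGraph

/-- A set of vertices is independent when it contains no edge. -/
def Indep {r : ℕ} {V : Type*} (H : RGraph r V) (A : Finset V) : Prop := ∀ e ∈ H.edges, ¬ e ⊆ A

theorem Indep.mono {r : ℕ} {V : Type*} {H : RGraph r V} {A B : Finset V} (hB : H.Indep B)
    (h : A ⊆ B) : H.Indep A := fun e he heA => hB e he (heA.trans h)

theorem indep_of_card_lt {r : ℕ} {V : Type*} {H : RGraph r V} {A : Finset V} (h : A.card < r) :
    H.Indep A := fun e he heA => by
  have := Finset.card_le_card heA
  rw [H.uniform e he] at this
  omega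

open Classical in
/-- The independent sets of size `j`. -/
noncomputable def indepSets {r : ℕ} {V : Type*} [Fintype V] (H : RGraph r V) (j : ℕ) : Finset (Finset V) :=
  (Finset.univ.powersetCard j).filter H.Indep

theorem mem_indepSets {r : ℕ} {V : Type*} [Fintype V] {H : RGraph r V} {j : ℕ} {A : Finset V} :
    A ∈ H.indepSets j ↔ A.card = j ∧ H.Indep A := by
  simp [indepSets, Finset.mem_powersetCard]

theorem indepSets_card_pos_of_le {r : ℕ} {V : Type*} [Fintype V] {H : RGraph r V} {i j : ℕ} (hij : i ≤ j)
    (h : 0 < (H.indepSets j).card) : 0 < (H.indepSets i).card := by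
  obtain ⟨A, hA⟩ := Finset.card_pos.1 h
  obtain ⟨hc, hI⟩ := mem_indepSets.1 hA
  obtain ⟨B, hB, hBc⟩ := Finset.exists_subset_card_eq (hc ▸ hij : i ≤ A.card)
  exact Finset.card_pos.2 ⟨B, mem_indepSets.2 ⟨hBc, hI.mono hB⟩⟩

theorem card_indepSets_two {V : Type*} [Fintype V] (H : RGraph 3 V) :
    (H.indepSets 2).card = (Fintype.card V).choose 2 := by
  rw [← Finset.card_univ, ← Finset.card_powersetCard]
  congr 1
  ext A
  rw [mem_indepSets, Finset.mem_powersetCard]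
  exact ⟨fun h => ⟨Finset.subset_univ _, h.1⟩,
    fun h => ⟨h.2, indep_of_card_lt (by omega)⟩⟩

section

variable {r : ℕ} {V : Type*} [Fintype V] [DecidableEq V]

open Classical in
/-- The vertices that extend `A` to a larger independent set. -/
noncomputable def extensions (H : RGraph r V) (A : Finset V) : Finset V :=
  Finset.univ.filter fun x => x ∉ A ∧ H.Indep (insert x A)

open Classical in
/-- The vertices outside `A` whose addition to `A` creates an edge. -/
noncomputable def blockers (H : RGraph r V) (A : Finset V) : Finset V :=
  Finset.univ.filter fun x => x ∉ A ∧ ¬ H.Indep (insert x A)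

theorem mem_extensions {H : RGraph r V} {A : Finset V} {x : V} :
    x ∈ H.extensions A ↔ x ∉ A ∧ H.Indep (insert x A) := by simp [extensions]

theorem mem_blockers {H : RGraph r V} {A : Finset V} {x : V} :
    x ∈ H.blockers A ↔ x ∉ A ∧ ¬ H.Indep (insert x A) := by simp [blockers]

theorem card_extensions_add_card_blockers (H : RGraph r V) (A : Finset V) :
    (H.extensions A).card + (H.blockers A).card = Fintype.card V - A.card := by
  classical
  rw [← Finset.card_compl, ← Finset.card_filter_add_card_filter_not
    (s := Aᶜ) (fun x => H.Indep (insert x A))]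
  congr 2 <;> ext x <;> simp [mem_extensions, mem_blockers]

theorem sum_extensions (H : RGraph r V) (i : ℕ) (F : Finset V → V → ℕ) :
    ∑ D ∈ H.indepSets i, ∑ y ∈ H.extensions D, F D y =
      ∑ A ∈ H.indepSets (i + 1), ∑ y ∈ A, F (A.erase y) y := by
  rw [Finset.sum_sigma', Finset.sum_sigma']
  refine Finset.sum_bij' (fun p _ => ⟨insert p.2 p.1, p.2⟩) (fun p _ => ⟨p.1.erase p.2, p.2⟩)
    ?_ ?_ ?_ ?_ ?_
  · rintro ⟨D, y⟩ h
    simp only [Finset.mem_sigma, mem_indepSets, mem_extensions] at h ⊢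
    exact ⟨⟨by rw [Finset.card_insert_of_notMem h.2.1, h.1.1], h.2.2⟩,
      Finset.mem_insert_self _ _⟩
  · rintro ⟨A, y⟩ h
    simp only [Finset.mem_sigma, mem_indepSets, mem_extensions] at h ⊢
    refine ⟨⟨by rw [Finset.card_erase_of_mem h.2, h.1.1]; rfl,
      h.1.2.mono (Finset.erase_subset _ _)⟩, Finset.notMem_erase _ _, ?_⟩
    rw [Finset.insert_erase h.2]
    exact h.1.2
  · rintro ⟨D, y⟩ h
    simp only [Finset.mem_sigma, mem_extensions] at h
    simp [Finset.erase_insert h.2.1]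
  · rintro ⟨A, y⟩ h
    simp only [Finset.mem_sigma] at h
    simp [Finset.insert_erase h.2]
  · rintro ⟨D, y⟩ h
    simp only [Finset.mem_sigma, mem_extensions] at h
    simp [Finset.erase_insert h.2.1]

theorem sum_card_extensions (H : RGraph r V) (i : ℕ) :
    ∑ D ∈ H.indepSets i, (H.extensions D).card = (i + 1) * (H.indepSets (i + 1)).card := by
  have h := H.sum_extensions i (fun _ _ => 1)
  simp only [Finset.sum_const, smul_eq_mul, mul_one] at h
  rw [h, Finset.sum_congr rfl (fun A hA => (mem_indepSets.1 hA).1), Finset.sum_const, smul_eq_mul,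
    mul_comm]

theorem mul_sum_blockers_le_sum_mul (H : RGraph 3 V) {i : ℕ} :
    (i - 1) * ∑ A ∈ H.indepSets (i + 1), (H.blockers A).card ≤
      ∑ D ∈ H.indepSets i, (H.extensions D).card * (H.blockers D).card := by
  classical
  have h := H.sum_extensions i (fun D _ => (H.blockers D).card)
  simp only [Finset.sum_const, smul_eq_mul] at h
  rw [h, Finset.mul_sum]
  refine Finset.sum_le_sum fun A hA => ?_
  obtain ⟨hcard, hind⟩ := mem_indepSets.1 hA
  calc (i - 1) * (H.blockers A).card = ∑ x ∈ H.blockers A, (i - 1) := by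
        rw [Finset.sum_const, smul_eq_mul, mul_comm]
    _ ≤ ∑ x ∈ H.blockers A, (A.filter fun y => ¬ H.Indep (insert x (A.erase y))).card := by
        refine Finset.sum_le_sum fun x hx => ?_
        obtain ⟨hxA, hx⟩ := mem_blockers.1 hx
        simp only [Indep, not_forall, not_not] at hx
        obtain ⟨e, he, heA⟩ := hx
        have hxe : x ∈ e := by
          by_contra hxe
          exact hind e he ((Finset.subset_insert_iff_of_notMem hxe).1 heA)
        have h1 : i - 1 ≤ (A \ (e.erase x)).card := by
          have h2 := Finset.le_card_sdiff (e.erase x) A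
          rw [Finset.card_erase_of_mem hxe, H.uniform e he, hcard] at h2
          omega
        refine h1.trans (Finset.card_le_card fun y hy => ?_)
        simp only [Finset.mem_sdiff, Finset.mem_erase, not_and] at hy
        refine Finset.mem_filter.2 ⟨hy.1, fun hI => hI e he fun z hz => ?_⟩
        by_cases hzx : z = x
        · simp [hzx]
        · have hzA : z ∈ A := (Finset.mem_insert.1 (heA hz)).resolve_left hzx
          have hyx : y ≠ x := fun h => hxA (h ▸ hy.1)
          have hzy : z ≠ y := fun h => hy.2 hyx (h ▸ hz)
          simp [hzA, hzy]
    _ = ∑ y ∈ A, ((H.blockers A).filter fun x => ¬ H.Indep (insert x (A.erase y))).card :=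
        Finset.sum_card_bipartiteAbove_eq_sum_card_bipartiteBelow
          (fun x y => ¬ H.Indep (insert x (A.erase y)))
    _ ≤ _ := by
        refine Finset.sum_le_sum fun y hy => Finset.card_le_card fun x hx => ?_
        simp only [Finset.mem_filter, mem_blockers] at hx ⊢
        exact ⟨fun h => hx.1.1 (Finset.mem_of_mem_erase h), hx.2⟩

theorem mul_sum_blockers_mul_card_le (H : RGraph 3 V) (i : ℕ) :
    (i - 1) * (∑ A ∈ H.indepSets (i + 1), (H.blockers A).card) * (H.indepSets i).card ≤
      (i + 1) * (H.indepSets (i + 1)).card * ∑ A ∈ H.indepSets i, (H.blockers A).card := by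
  have h1 : AntivaryOn (fun A => (H.extensions A).card) (fun A => (H.blockers A).card)
      (H.indepSets i : Set (Finset V)) := by
    intro A hA B hB hlt
    have hA' := H.card_extensions_add_card_blockers A
    have hB' := H.card_extensions_add_card_blockers B
    rw [(mem_indepSets.1 (Finset.mem_coe.1 hA)).1] at hA'
    rw [(mem_indepSets.1 (Finset.mem_coe.1 hB)).1] at hB'
    dsimp only at hlt ⊢
    omega
  have h2 : (H.indepSets i).card *
      ∑ D ∈ H.indepSets i, (H.extensions D).card * (H.blockers D).card ≤
      (∑ D ∈ H.indepSets i, (H.extensions D).card) *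
        ∑ D ∈ H.indepSets i, (H.blockers D).card := by
    have := (AntivaryOn.card_mul_sum_le_sum_mul_sum
      (f := fun A => ((H.extensions A).card : ℤ)) (g := fun A => ((H.blockers A).card : ℤ))
      (s := H.indepSets i) (fun A hA B hB hlt => by
        have := h1 hA hB (Int.ofNat_lt.1 hlt)
        exact Int.ofNat_le.2 this))
    exact_mod_cast this
  rw [sum_card_extensions] at h2
  calc _ = (H.indepSets i).card *
        ((i - 1) * ∑ A ∈ H.indepSets (i + 1), (H.blockers A).card) := by ring
    _ ≤ _ := Nat.mul_le_mul_left _ H.mul_sum_blockers_le_sum_mul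
    _ ≤ _ := h2

theorem sum_blockers_two (H : RGraph 3 V) :
    ∑ A ∈ H.indepSets 2, (H.blockers A).card = 3 * H.edges.card := by
  have h3 : ∀ e ∈ H.edges, e.card = 3 := H.uniform
  have : 3 * H.edges.card = ∑ e ∈ H.edges, e.card := by
    rw [Finset.sum_congr rfl h3, Finset.sum_const, smul_eq_mul, mul_comm]
  rw [this, ← Finset.card_sigma, ← Finset.card_sigma]
  refine Finset.card_bij' (fun p _ => ⟨insert p.2 p.1, p.2⟩) (fun p _ => ⟨p.1.erase p.2, p.2⟩)
    ?_ ?_ ?_ ?_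
  · rintro ⟨D, y⟩ h
    simp only [Finset.mem_sigma, mem_indepSets, mem_blockers] at h ⊢
    refine ⟨?_, Finset.mem_insert_self _ _⟩
    have h2 := h.2.2
    simp only [Indep, not_forall, not_not] at h2
    obtain ⟨e, he, heA⟩ := h2
    have := Finset.eq_of_subset_of_card_le heA
      (by rw [H.uniform e he, Finset.card_insert_of_notMem h.2.1, h.1.1])
    rwa [← this]
  · rintro ⟨A, y⟩ h
    simp only [Finset.mem_sigma, mem_indepSets, mem_blockers] at h ⊢
    have hc : (A.erase y).card = 2 := by rw [Finset.card_erase_of_mem h.2, h3 A h.1]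
    refine ⟨⟨hc, indep_of_card_lt (by omega)⟩, Finset.notMem_erase _ _, ?_⟩
    rw [Finset.insert_erase h.2]
    exact fun hI => hI A h.1 subset_rfl
  · rintro ⟨D, y⟩ h
    simp only [Finset.mem_sigma, mem_blockers] at h
    simp [Finset.erase_insert h.2.1]
  · rintro ⟨A, y⟩ h
    simp only [Finset.mem_sigma] at h
    simp [Finset.insert_erase h.2]

theorem sum_blockers_mul_choose_le (H : RGraph 3 V) (j : ℕ) :
    (∑ A ∈ H.indepSets (j + 2), (H.blockers A).card) * (Fintype.card V).choose 2 ≤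
      (j + 2).choose 2 * (3 * H.edges.card) * (H.indepSets (j + 2)).card := by
  induction j with
  | zero => rw [zero_add, sum_blockers_two, card_indepSets_two]; simp
  | succ j ih =>
    rcases Nat.eq_zero_or_pos (H.indepSets (j + 1 + 2)).card with h0 | hpos
    · rw [Finset.card_eq_zero.1 h0]; simp
    · have hp : 0 < (H.indepSets (j + 2)).card := indepSets_card_pos_of_le (by omega) hpos
      have h := H.mul_sum_blockers_mul_card_le (j + 2)
      have hch : (j + 1) * (j + 3).choose 2 = (j + 3) * (j + 2).choose 2 := by
        have := Nat.choose_mul_succ_eq (j + 2) 2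
        simp only [Nat.succ_sub_succ_eq_sub, tsub_zero] at this
        linarith
      refine Nat.le_of_mul_le_mul_left ?_ (Nat.mul_pos j.succ_pos hp)
      have e1 : j + 2 - 1 = j + 1 := rfl
      rw [e1] at h
      have e2 : j + 1 + 2 = j + 2 + 1 := by omega
      rw [e2]
      set M := ∑ A ∈ H.indepSets (j + 2 + 1), (H.blockers A).card
      set M' := ∑ A ∈ H.indepSets (j + 2), (H.blockers A).card
      set N := (H.indepSets (j + 2 + 1)).card
      set N' := (H.indepSets (j + 2)).card
      set c := (Fintype.card V).choose 2
      calc (j + 1) * N' * (M * c) = (j + 1) * M * N' * c := by ring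
        _ ≤ (j + 2 + 1) * N * M' * c := Nat.mul_le_mul_right _ h
        _ = (j + 3) * N * (M' * c) := by ring
        _ ≤ (j + 3) * N * ((j + 2).choose 2 * (3 * H.edges.card) * N') :=
            Nat.mul_le_mul_left _ ih
        _ = ((j + 3) * (j + 2).choose 2) * N * (3 * H.edges.card) * N' := by ring
        _ = ((j + 1) * (j + 3).choose 2) * N * (3 * H.edges.card) * N' := by rw [hch]
        _ = (j + 1) * N' * ((j + 2 + 1).choose 2 * (3 * H.edges.card) * N) := by ring

/-- De Caen's bound for `3`-graphs. -/
theorem Covers.sub_mul_choose_le {H : RGraph 3 V} {k : ℕ} (hH : H.Covers k)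
    (hV : 2 ≤ Fintype.card V) :
    (Fintype.card V + 1 - k) * (Fintype.card V).choose 2 ≤
      (k - 1).choose 2 * (3 * H.edges.card) := by
  classical
  have hk0 : (H.indepSets k).card = 0 := by
    rw [Finset.card_eq_zero, Finset.eq_empty_iff_forall_notMem]
    intro A hA
    obtain ⟨hc, hI⟩ := mem_indepSets.1 hA
    obtain ⟨e, he, heA⟩ := hH A hc
    exact hI e he heA
  have hex : ∃ j, (H.indepSets (j + 2)).card = 0 := by
    refine ⟨k, Nat.eq_zero_of_not_pos fun h => ?_⟩
    exact (indepSets_card_pos_of_le (by omega : k ≤ k + 2) h).ne' hk0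
  obtain ⟨j, hj, hmin⟩ : ∃ j, (H.indepSets (j + 2)).card = 0 ∧
      ∀ i < j, (H.indepSets (i + 2)).card ≠ 0 :=
    ⟨Nat.find hex, Nat.find_spec hex, fun i hi => Nat.find_min hex hi⟩
  have h2 : 0 < (H.indepSets 2).card := by rw [card_indepSets_two]; exact Nat.choose_pos hV
  obtain ⟨i, rfl⟩ : ∃ i, j = i + 1 := Nat.exists_eq_succ_of_ne_zero (by
    rintro rfl; exact h2.ne' hj)
  have hi := Nat.pos_of_ne_zero (hmin i (Nat.lt_succ_self i))
  have hik : i + 3 ≤ k := by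
    by_contra hlt
    exact (indepSets_card_pos_of_le (by omega : k ≤ i + 2) hi).ne' hk0
  have hM : ∑ A ∈ H.indepSets (i + 2), (H.blockers A).card =
      (Fintype.card V - (i + 2)) * (H.indepSets (i + 2)).card := by
    rw [mul_comm, ← smul_eq_mul, ← Finset.sum_const]
    refine Finset.sum_congr rfl fun A hA => ?_
    have h1 := H.card_extensions_add_card_blockers A
    have h3 : ∑ D ∈ H.indepSets (i + 2), (H.extensions D).card = 0 := by
      rw [sum_card_extensions, show i + 2 + 1 = i + 1 + 2 by omega, hj, mul_zero]
    rw [Finset.sum_eq_zero_iff.1 h3 A hA, (mem_indepSets.1 hA).1] at h1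
    omega
  have h := H.sum_blockers_mul_choose_le i
  rw [hM] at h
  have h' : (Fintype.card V - (i + 2)) * (Fintype.card V).choose 2 ≤
      (i + 2).choose 2 * (3 * H.edges.card) := by
    refine Nat.le_of_mul_le_mul_right ?_ hi
    calc _ = (Fintype.card V - (i + 2)) * (H.indepSets (i + 2)).card *
          (Fintype.card V).choose 2 := by ring
      _ ≤ _ := h
  calc _ ≤ (Fintype.card V - (i + 2)) * (Fintype.card V).choose 2 :=
        Nat.mul_le_mul_right _ (by omega)
    _ ≤ _ := h'
    _ ≤ _ := Nat.mul_le_mul_right _ (Nat.choose_le_choose 2 (by omega))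

end

end RGraph

theorem RGraph.Covers.dualTuran_le {r k : ℕ} {V : Type*} [Fintype V] {H : RGraph r V}
    (hH : H.Covers k) : dualTuran (Fintype.card V) k r ≤ H.edges.card := by
  classical
  rw [← Finset.card_univ]
  exact (dualTuran_card_le H Finset.univ fun A _ hA => hH A hA).trans
    (Finset.card_filter_le _ _)

theorem six_mul_choose_three (n : ℕ) :
    6 * (n.choose 3 : ℝ) = n * ((n : ℝ) - 1) * ((n : ℝ) - 2) := by
  rcases n with _ | _ | n
  · simp
  · simp [Nat.choose]
  · have h := Nat.descFactorial_eq_factorial_mul_choose (n + 2) 3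
    simp only [Nat.descFactorial, Nat.factorial] at h
    have h' : ((n + 2 - 2) * ((n + 2 - 1) * ((n + 2 - 0) * 1)) : ℕ) =
      n * ((n + 1) * (n + 2)) := by simp
    rw [h'] at h
    have : ((n * ((n + 1) * (n + 2)) : ℕ) : ℝ) = 6 * ((n + 2).choose 3 : ℝ) := by
      rw [h]; push_cast; ring
    push_cast at this ⊢
    linarith

theorem six_mul_choose_three_le (n : ℕ) : 6 * (n.choose 3 : ℝ) ≤ (n : ℝ) ^ 3 := by
  rw [six_mul_choose_three]
  rcases n with _ | n
  · simp
  · push_cast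
    have : (0 : ℝ) ≤ n := n.cast_nonneg
    nlinarith [sq_nonneg (n : ℝ)]

theorem le_six_mul_choose_three (n : ℕ) :
    (n : ℝ) ^ 3 - 3 * (n : ℝ) ^ 2 ≤ 6 * (n.choose 3 : ℝ) := by
  rw [six_mul_choose_three]
  have : (0 : ℝ) ≤ n := n.cast_nonneg
  nlinarith

theorem three_mul_choose_three {n : ℕ} (hn : 2 ≤ n) :
    3 * (n.choose 3 : ℝ) = (n.choose 2 : ℝ) * ((n : ℝ) - 2) := by
  have h := Nat.choose_succ_right_eq n 2
  have : ((n.choose 3 * 3 : ℕ) : ℝ) = ((n.choose 2 * (n - 2) : ℕ) : ℝ) := by exact_mod_cast h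
  rw [Nat.cast_mul, Nat.cast_mul, Nat.cast_sub hn] at this
  push_cast at this
  linarith

/-- The asymptotic form of de Caen's bound for `3`-graphs. -/
theorem one_div_choose_le_turanLimit {k : ℕ} (hk : 3 ≤ k) :
    1 / ((k - 1).choose 2 : ℝ) ≤ turanLimit 3 k := by
  have hpos : 0 < (k - 1).choose 2 := Nat.choose_pos (by omega)
  have hpos' : (0 : ℝ) < (k - 1).choose 2 := by exact_mod_cast hpos
  have hlim : Tendsto (fun n : ℕ => ((n : ℝ) + (1 - k)) / ((n : ℝ) + (-2)) /
      ((k - 1).choose 2 : ℝ)) atTop (𝓝 (1 / ((k - 1).choose 2 : ℝ))) := by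
    refine Tendsto.div_const ?_ _
    have h := (tendsto_add_mul_div_add_mul_atTop_nhds (𝕜 := ℝ) (1 - k) (-2) 1
      (one_ne_zero (α := ℝ)))
    simpa [add_comm] using h
  refine le_of_tendsto_of_tendsto hlim (tendsto_dualTuranRatio hk) ?_
  filter_upwards [eventually_ge_atTop k] with n hn
  obtain ⟨H, hH, hc⟩ := exists_card_eq_dualTuran hk n
  have h := hc.sub_mul_choose_le (by rw [Fintype.card_fin]; omega)
  rw [Fintype.card_fin, hH] at h
  have h' : ((n : ℝ) + (1 - k)) * (n.choose 2 : ℝ) ≤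
      ((k - 1).choose 2 : ℝ) * (3 * (dualTuran n k 3 : ℝ)) := by
    have : (((n + 1 - k) * n.choose 2 : ℕ) : ℝ) ≤
      (((k - 1).choose 2 * (3 * dualTuran n k 3) : ℕ) : ℝ) := by exact_mod_cast h
    rw [Nat.cast_mul, Nat.cast_sub (by omega)] at this
    push_cast at this
    linarith
  have h2 : (0 : ℝ) < n.choose 2 := by exact_mod_cast Nat.choose_pos (by omega)
  have h3 : (0 : ℝ) < (n : ℝ) + (-2) := by
    have : (3 : ℝ) ≤ n := by exact_mod_cast hk.trans hn
    linarith
  have hch := three_mul_choose_three (n := n) (by omega)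
  have hc3 : (n.choose 3 : ℝ) = (n.choose 2 : ℝ) * ((n : ℝ) + (-2)) / 3 := by linarith
  rw [dualTuranRatio, hc3, div_div, div_le_div_iff₀ (by positivity) (by positivity)]
  calc ((n : ℝ) + (1 - k)) * ((n.choose 2 : ℝ) * ((n : ℝ) + (-2)) / 3)
      = ((n : ℝ) + (1 - k)) * (n.choose 2 : ℝ) * (((n : ℝ) + (-2)) / 3) := by ring
    _ ≤ ((k - 1).choose 2 : ℝ) * (3 * (dualTuran n k 3 : ℝ)) * (((n : ℝ) + (-2)) / 3) :=
        mul_le_mul_of_nonneg_right h' (by positivity)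
    _ = _ := by ring

theorem turanLimit_three_pos {k : ℕ} (hk : 3 ≤ k) : 0 < turanLimit 3 k := by
  have hpos : 0 < (k - 1).choose 2 := Nat.choose_pos (by omega)
  have hpos' : (0 : ℝ) < (k - 1).choose 2 := by exact_mod_cast hpos
  exact lt_of_lt_of_le (by positivity) (one_div_choose_le_turanLimit hk)

theorem turanLimit_three_three : turanLimit 3 3 = 1 :=
  le_antisymm (turanLimit_le_one le_rfl) (by
    have := one_div_choose_le_turanLimit (le_refl 3)
    simpa using this)

/-- A lower bound for `6 T(n, K_k^{(3)})`, uniform in `n ≤ N`. -/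
theorem eventually_turanLimit_mul_le {k : ℕ} (hk : 3 ≤ k) {ε : ℝ} (hε : 0 < ε) :
    ∀ᶠ N : ℕ in atTop, ∀ n ≤ N,
      turanLimit 3 k * (n : ℝ) ^ 3 - ε * (N : ℝ) ^ 3 ≤ 6 * (dualTuran n k 3 : ℝ) := by
  have ht1 := turanLimit_le_one hk
  have ht0 := (turanLimit_three_pos hk).le
  obtain ⟨n₀, hn₀⟩ := eventually_atTop.1 ((tendsto_dualTuranRatio hk).eventually
    (lt_mem_nhds (show turanLimit 3 k - ε / 2 < turanLimit 3 k by linarith)))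
  obtain ⟨N₀, hN₀⟩ := exists_nat_ge (2 * (3 + (n₀ : ℝ) ^ 3) / ε)
  filter_upwards [eventually_ge_atTop N₀, eventually_ge_atTop 1] with N hN hN1 n hn
  have hnN : (n : ℝ) ≤ N := by exact_mod_cast hn
  have hN1' : (1 : ℝ) ≤ N := by exact_mod_cast hN1
  have hn0 : (0 : ℝ) ≤ n := n.cast_nonneg
  have hn3 : (n : ℝ) ^ 3 ≤ (N : ℝ) ^ 3 := pow_le_pow_left₀ hn0 hnN 3
  have hn2 : (n : ℝ) ^ 2 ≤ (N : ℝ) ^ 2 := pow_le_pow_left₀ hn0 hnN 2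
  have hbig : (3 + (n₀ : ℝ) ^ 3) * (N : ℝ) ^ 2 ≤ ε / 2 * (N : ℝ) ^ 3 := by
    have h1 : 2 * (3 + (n₀ : ℝ) ^ 3) / ε ≤ N := hN₀.trans (by exact_mod_cast hN)
    rw [div_le_iff₀ hε] at h1
    calc (3 + (n₀ : ℝ) ^ 3) * (N : ℝ) ^ 2 ≤ (N * ε / 2) * (N : ℝ) ^ 2 :=
          mul_le_mul_of_nonneg_right (by linarith) (by positivity)
      _ = _ := by ring
  have hN2 : (1 : ℝ) ≤ (N : ℝ) ^ 2 := one_le_pow₀ hN1'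
  have hn₀3 : (0 : ℝ) ≤ (n₀ : ℝ) ^ 3 := by positivity
  rcases lt_or_ge n n₀ with hlt | hge
  · have h1 : (n : ℝ) ^ 3 ≤ (n₀ : ℝ) ^ 3 := pow_le_pow_left₀ hn0 (by exact_mod_cast hlt.le) 3
    have h2 : turanLimit 3 k * (n : ℝ) ^ 3 ≤ 1 * (n : ℝ) ^ 3 :=
      mul_le_mul_of_nonneg_right ht1 (by positivity)
    have h3 : (0 : ℝ) ≤ 6 * (dualTuran n k 3 : ℝ) := by positivity
    have h4 : (n₀ : ℝ) ^ 3 * 1 ≤ (n₀ : ℝ) ^ 3 * (N : ℝ) ^ 2 :=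
      mul_le_mul_of_nonneg_left hN2 hn₀3
    have h5 : 0 ≤ ε * (N : ℝ) ^ 3 := by positivity
    nlinarith
  · have hr := hn₀ n hge
    have hr1 := dualTuranRatio_le_one hk n
    have hr0 := dualTuranRatio_nonneg 3 k n
    have hT : 6 * (dualTuran n k 3 : ℝ) = dualTuranRatio 3 k n * (6 * (n.choose 3 : ℝ)) := by
      rcases lt_or_ge n 3 with h | h
      · have := dualTuran_le_choose hk n
        rw [Nat.choose_eq_zero_of_lt h] at this
        simp [Nat.choose_eq_zero_of_lt h, Nat.le_zero.1 this]
      · have : (n.choose 3 : ℝ) ≠ 0 := by exact_mod_cast (Nat.choose_pos h).ne'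
        rw [dualTuranRatio]
        field_simp
    have h1 : dualTuranRatio 3 k n * ((n : ℝ) ^ 3 - 3 * (n : ℝ) ^ 2) ≤
        6 * (dualTuran n k 3 : ℝ) := by
      rw [hT]
      exact mul_le_mul_of_nonneg_left (le_six_mul_choose_three n) hr0
    have h2 : (turanLimit 3 k - ε / 2) * (n : ℝ) ^ 3 ≤ dualTuranRatio 3 k n * (n : ℝ) ^ 3 :=
      mul_le_mul_of_nonneg_right hr.le (by positivity)
    have h3 : dualTuranRatio 3 k n * (3 * (n : ℝ) ^ 2) ≤ 1 * (3 * (n : ℝ) ^ 2) :=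
      mul_le_mul_of_nonneg_right hr1 (by positivity)
    have h4 : ε / 2 * (n : ℝ) ^ 3 ≤ ε / 2 * (N : ℝ) ^ 3 :=
      mul_le_mul_of_nonneg_left hn3 (by positivity)
    have h5 : 0 ≤ (n₀ : ℝ) ^ 3 * (N : ℝ) ^ 2 := by positivity
    nlinarith

/-- Turán's construction: three parts of size `q` in cyclic order; the edges are the triples inside
a part and the triples with two vertices in a part and one in the next part. -/
def turanConstruction (q : ℕ) : RGraph 3 (Fin 3 × Fin q) where
  edges := (Finset.univ ×ˢ Finset.univ.powersetCard 3).image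
      (fun p : Fin 3 × Finset (Fin q) => p.2.map (Function.Embedding.sectR p.1 _)) ∪
    (Finset.univ ×ˢ Finset.univ.powersetCard 2 ×ˢ Finset.univ).image
      (fun p : Fin 3 × Finset (Fin q) × Fin q =>
        insert (p.1 + 1, p.2.2) (p.2.1.map (Function.Embedding.sectR p.1 _)))
  uniform e he := by
    simp only [Finset.mem_union, Finset.mem_image, Finset.mem_product, Finset.mem_univ,
      Finset.mem_powersetCard, true_and, Finset.subset_univ, and_true] at he
    rcases he with ⟨p, hp, rfl⟩ | ⟨p, hp, rfl⟩
    · rwa [Finset.card_map]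
    · rw [Finset.card_insert_of_notMem, Finset.card_map, hp]
      simp only [Finset.mem_map, Function.Embedding.sectR_apply, Prod.mk.injEq, not_exists, not_and]
      intro x _ h
      exact absurd h (by generalize p.1 = i; revert i; decide)

theorem card_turanConstruction_le (q : ℕ) :
    (turanConstruction q).edges.card ≤ 3 * q.choose 3 + 3 * (q.choose 2 * q) := by
  refine (Finset.card_union_le _ _).trans (Nat.add_le_add ?_ ?_)
  · refine Finset.card_image_le.trans ?_
    simp [Finset.card_product, Finset.card_powersetCard]
  · refine Finset.card_image_le.trans ?_
    simp [Finset.card_product, Finset.card_powersetCard]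

theorem turanConstruction_covers (q : ℕ) : (turanConstruction q).Covers 4 := by
  intro S hS
  let g : Fin 4 → Fin 3 × Fin q := fun i => (S.equivFinOfCardEq hS).symm i
  have hg : Function.Injective g :=
    Subtype.val_injective.comp (S.equivFinOfCardEq hS).symm.injective
  have hgS : ∀ i, g i ∈ S := fun i => ((S.equivFinOfCardEq hS).symm i).2
  have key : ∀ f : Fin 4 → Fin 3, ∃ i j k : Fin 4, i ≠ j ∧ i ≠ k ∧ j ≠ k ∧ f i = f j ∧
      (f k = f i ∨ f k = f i + 1) := by decide +kernel
  obtain ⟨i, j, k, hij, hik, hjk, h1, h2⟩ := key fun i => (g i).1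
  have hne : ∀ {a b}, a ≠ b → (g a).1 = (g b).1 → (g a).2 ≠ (g b).2 :=
    fun hab h h' => hab (hg (Prod.ext h h'))
  rcases h2 with h2 | h2
  · refine ⟨({(g i).2, (g j).2, (g k).2} : Finset (Fin q)).map
      (Function.Embedding.sectR (g i).1 _), Finset.mem_union_left _ (Finset.mem_image.2
      ⟨((g i).1, {(g i).2, (g j).2, (g k).2}), ?_, rfl⟩), ?_⟩
    · simp only [Finset.mem_product, Finset.mem_univ, Finset.mem_powersetCard, true_and,
        Finset.subset_univ]
      exact Finset.card_eq_three.2 ⟨_, _, _, hne hij h1, hne hik h2.symm,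
        hne hjk (h1.symm.trans h2.symm), rfl⟩
    · intro x hx
      simp only [Finset.mem_map, Finset.mem_insert, Finset.mem_singleton,
        Function.Embedding.sectR_apply] at hx
      obtain ⟨y, rfl | rfl | rfl, rfl⟩ := hx
      · exact hgS i
      · rw [h1]; exact hgS j
      · rw [← h2]; exact hgS k
  · refine ⟨insert ((g i).1 + 1, (g k).2) (({(g i).2, (g j).2} : Finset (Fin q)).map
      (Function.Embedding.sectR (g i).1 _)), Finset.mem_union_right _ (Finset.mem_image.2
      ⟨((g i).1, {(g i).2, (g j).2}, (g k).2), ?_, rfl⟩), ?_⟩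
    · simp only [Finset.mem_product, Finset.mem_univ, Finset.mem_powersetCard, true_and,
        Finset.subset_univ, and_true]
      exact Finset.card_pair (hne hij h1)
    · intro x hx
      simp only [Finset.mem_map, Finset.mem_insert, Finset.mem_singleton,
        Function.Embedding.sectR_apply] at hx
      obtain rfl | ⟨y, rfl | rfl, rfl⟩ := hx
      · rw [← h2]; exact hgS k
      · exact hgS i
      · rw [h1]; exact hgS j

theorem dualTuran_three_mul_le (q : ℕ) : 6 * (dualTuran (3 * q) 4 3 : ℝ) ≤ 12 * (q : ℝ) ^ 3 := by
  have h := (turanConstruction_covers q).dualTuran_le.trans (card_turanConstruction_le q)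
  rw [Fintype.card_prod, Fintype.card_fin, Fintype.card_fin] at h
  have h' : (dualTuran (3 * q) 4 3 : ℝ) ≤ 3 * (q.choose 3 : ℝ) + 3 * ((q.choose 2 : ℝ) * q) := by
    exact_mod_cast h
  have h3 := six_mul_choose_three_le q
  have h2 : (q.choose 2 : ℝ) ≤ (q : ℝ) ^ 2 / 2 := by
    rw [Nat.cast_choose_two]
    have : (0 : ℝ) ≤ q := q.cast_nonneg
    nlinarith
  have := mul_le_mul_of_nonneg_right h2 q.cast_nonneg
  nlinarith

theorem turanLimit_three_four_le : turanLimit 3 4 ≤ 4 / 9 := by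
  refine le_of_forall_pos_le_add fun ε hε => ?_
  obtain ⟨N, hN⟩ := eventually_atTop.1 (eventually_turanLimit_mul_le (k := 4) (by omega) hε)
  have h := (hN (3 * (N + 1)) (by omega) _ le_rfl).trans (dualTuran_three_mul_le (N + 1))
  push_cast at h
  have hq : (0 : ℝ) < ((N : ℝ) + 1) ^ 3 := by positivity
  refine le_of_mul_le_mul_right ?_ (show (0 : ℝ) < 27 * ((N : ℝ) + 1) ^ 3 by positivity)
  nlinarith

theorem SimpleGraph.Reachable.apply_eq {V α : Type*} {G : SimpleGraph V} {f : V → α}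
    (hf : ∀ x y, G.Adj x y → f x = f y) {x y : V} (h : G.Reachable x y) : f x = f y := by
  obtain ⟨w⟩ := h
  induction w with
  | nil => rfl
  | cons hadj _ ih => exact (hf _ _ hadj).trans ih

theorem SimpleGraph.card_connectedComponent_sum {V W : Type*} [Finite V] [Finite W]
    (G : SimpleGraph V) (H : SimpleGraph W) :
    Nat.card (G ⊕g H).ConnectedComponent =
      Nat.card G.ConnectedComponent + Nat.card H.ConnectedComponent := by
  have hinv : ∀ x y, (G ⊕g H).Adj x y →
      Sum.map G.connectedComponentMk H.connectedComponentMk x =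
        Sum.map G.connectedComponentMk H.connectedComponentMk y := by
    rintro (x | x) (y | y) h
    · simpa using (SimpleGraph.sum_adj_inl.1 h).reachable
    · simp at h
    · simp at h
    · simpa using (SimpleGraph.sum_adj_inr.1 h).reachable
  rw [← Nat.card_sum]
  refine (Nat.card_congr (Equiv.ofBijective (Sum.elim
    (SimpleGraph.ConnectedComponent.map (SimpleGraph.Embedding.sumInl (H := H)).toHom)
    (SimpleGraph.ConnectedComponent.map (SimpleGraph.Embedding.sumInr (G := G)).toHom))
    ⟨?_, ?_⟩)).symm
  · rintro (x | x) (y | y) <;> induction x using SimpleGraph.ConnectedComponent.ind <;>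
      induction y using SimpleGraph.ConnectedComponent.ind <;> intro h <;>
      simpa using SimpleGraph.Reachable.apply_eq hinv (SimpleGraph.ConnectedComponent.exact h)
  · intro x
    induction x using SimpleGraph.ConnectedComponent.ind with | _ x => ?_
    rcases x with x | x
    · exact ⟨.inl (G.connectedComponentMk x), rfl⟩
    · exact ⟨.inr (H.connectedComponentMk x), rfl⟩

namespace RGraph

theorem Covers.exists_subset {r k : ℕ} {V : Type*} {H : RGraph r V} (hH : H.Covers k)
    {S : Finset V} (hS : k ≤ S.card) : ∃ e ∈ H.edges, e ⊆ S := by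
  obtain ⟨A, hA, hc⟩ := Finset.exists_subset_card_eq hS
  obtain ⟨e, he, heA⟩ := hH A hc
  exact ⟨e, he, heA.trans hA⟩

/-- The shadow of a pullback along a bijection is isomorphic to the original shadow. -/
def shadowComapIso {r : ℕ} {V W : Type*} (H : RGraph r W) (f : V ≃ W) :
    (H.comap f.toEmbedding).shadow ≃g H.shadow where
  toEquiv := f
  map_rel_iff' := by
    intro a b
    refine and_congr f.injective.ne_iff ⟨?_, ?_⟩
    · rintro ⟨e, he, ha, hb⟩
      refine ⟨e.map f.symm.toEmbedding, ?_, by simpa using ha, by simpa using hb⟩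
      rw [mem_comap_edges, Finset.map_map]
      simpa using he
    · rintro ⟨e, he, ha, hb⟩
      exact ⟨e.map f.toEmbedding, mem_comap_edges.1 he, by simpa using ha, by simpa using hb⟩

theorem numComponents_comap {r : ℕ} {V W : Type*} (H : RGraph r W) (f : V ≃ W) :
    (H.comap f.toEmbedding).numComponents = H.numComponents :=
  Nat.card_congr (H.shadowComapIso f).connectedComponentEquiv

theorem card_comap_edges_le {r : ℕ} {V W : Type*} (H : RGraph r W) (f : V ↪ W) :
    (H.comap f).edges.card ≤ H.edges.card :=
  Finset.card_le_card_of_injOn (Finset.map f) (fun _ he => mem_comap_edges.1 he)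
    (Finset.map_injective f).injOn

theorem Covers.comap {r k : ℕ} {V W : Type*} {H : RGraph r W} (hH : H.Covers k) (f : V ↪ W) :
    (H.comap f).Covers k := by
  intro A hA
  obtain ⟨e, he, heA⟩ := hH (A.map f) (by rwa [Finset.card_map])
  obtain ⟨e', he', rfl⟩ := Finset.subset_map_iff.1 heA
  exact ⟨e', mem_comap_edges.2 he, he'⟩

open Classical in
/-- The disjoint union of two `r`-graphs. -/
noncomputable def sum {r : ℕ} {V W : Type*} (G : RGraph r V) (H : RGraph r W) :
    RGraph r (V ⊕ W) where
  edges := G.edges.map (Finset.mapEmbedding Function.Embedding.inl).toEmbedding ∪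
    H.edges.map (Finset.mapEmbedding Function.Embedding.inr).toEmbedding
  uniform e he := by
    rcases Finset.mem_union.1 he with he | he
    · obtain ⟨e', he', rfl⟩ := Finset.mem_map.1 he
      simpa using G.uniform e' he'
    · obtain ⟨e', he', rfl⟩ := Finset.mem_map.1 he
      simpa using H.uniform e' he'

theorem mem_sum_edges {r : ℕ} {V W : Type*} {G : RGraph r V} {H : RGraph r W}
    {e : Finset (V ⊕ W)} : e ∈ (G.sum H).edges ↔
      (∃ e' ∈ G.edges, e'.map Function.Embedding.inl = e) ∨
        ∃ e' ∈ H.edges, e'.map Function.Embedding.inr = e := by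
  simp [sum]

theorem card_sum_edges_le {r : ℕ} {V W : Type*} (G : RGraph r V) (H : RGraph r W) :
    (G.sum H).edges.card ≤ G.edges.card + H.edges.card := by
  classical
  refine (Finset.card_union_le _ _).trans ?_
  rw [Finset.card_map, Finset.card_map]

theorem shadow_sum {r : ℕ} {V W : Type*} (G : RGraph r V) (H : RGraph r W) :
    (G.sum H).shadow = G.shadow ⊕g H.shadow := by
  ext x y
  rcases x with x | x <;> rcases y with y | y <;>
    simp [shadow, mem_sum_edges, or_and_right, exists_or, SimpleGraph.sum]

theorem numComponents_sum {r : ℕ} {V W : Type*} [Finite V] [Finite W] (G : RGraph r V)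
    (H : RGraph r W) : (G.sum H).numComponents = G.numComponents + H.numComponents := by
  rw [numComponents, shadow_sum, SimpleGraph.card_connectedComponent_sum]
  rfl

theorem Covers.sum {r a b : ℕ} {V W : Type*} {G : RGraph r V} {H : RGraph r W}
    (hG : G.Covers (a + 1)) (hH : H.Covers (b + 1)) : (G.sum H).Covers (a + b + 1) := by
  classical
  intro S hS
  have h := S.card_toLeft_add_card_toRight
  rcases le_or_gt (a + 1) S.toLeft.card with h1 | h1
  · obtain ⟨e, he, heS⟩ := hG.exists_subset h1
    refine ⟨_, mem_sum_edges.2 (Or.inl ⟨e, he, rfl⟩), fun x hx => ?_⟩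
    obtain ⟨y, hy, rfl⟩ := Finset.mem_map.1 hx
    exact Finset.mem_toLeft.1 (heS hy)
  · obtain ⟨e, he, heS⟩ := hH.exists_subset (by omega : b + 1 ≤ S.toRight.card)
    refine ⟨_, mem_sum_edges.2 (Or.inr ⟨e, he, rfl⟩), fun x hx => ?_⟩
    obtain ⟨y, hy, rfl⟩ := Finset.mem_map.1 hx
    exact Finset.mem_toRight.1 (heS hy)

theorem numComponents_eq_one {V : Type*} [Fintype V] {H : RGraph 3 V}
    (hV : 3 ≤ Fintype.card V) (v : V) (hv : ∀ e : Finset V, e.card = 3 → v ∈ e → e ∈ H.edges) :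
    H.numComponents = 1 := by
  classical
  have hadj : ∀ u, H.shadow.Reachable v u := by
    intro u
    by_cases hu : v = u
    · rw [hu]
    · obtain ⟨e, he, hc⟩ := Finset.exists_superset_card_eq (s := {v, u}) (n := 3)
        (Finset.card_le_two.trans (by norm_num)) hV
      have hve : v ∈ e := he (by simp)
      exact SimpleGraph.Adj.reachable ⟨hu, e, hv e hc hve, hve, he (by simp)⟩
  rw [numComponents, Nat.card_eq_one_iff_unique]
  refine ⟨SimpleGraph.Preconnected.subsingleton_connectedComponent
    fun a b => (hadj a).symm.trans (hadj b), ⟨H.shadow.connectedComponentMk v⟩⟩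

open Classical in
/-- The `3`-graph obtained by adding all edges through the vertex `v`. -/
noncomputable def addStar {V : Type*} [Fintype V] (H : RGraph 3 V) (v : V) : RGraph 3 V where
  edges := H.edges ∪ (Finset.univ.powersetCard 3).filter (v ∈ ·)
  uniform e he := by
    rcases Finset.mem_union.1 he with he | he
    · exact H.uniform e he
    · exact (Finset.mem_powersetCard.1 (Finset.mem_filter.1 he).1).2

theorem mem_addStar_edges {V : Type*} [Fintype V] {H : RGraph 3 V} {v : V} {e : Finset V} :
    e ∈ (H.addStar v).edges ↔ e ∈ H.edges ∨ e.card = 3 ∧ v ∈ e := by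
  simp [addStar, Finset.mem_powersetCard]

theorem card_addStar_edges_le {V : Type*} [Fintype V] (H : RGraph 3 V) (v : V) :
    (H.addStar v).edges.card ≤ H.edges.card + Fintype.card V ^ 2 := by
  classical
  refine (Finset.card_union_le _ _).trans (Nat.add_le_add_left ?_ _)
  calc _ ≤ ((Finset.univ.powersetCard 2).image (insert v)).card := by
        refine Finset.card_le_card fun e he => ?_
        simp only [Finset.mem_filter, Finset.mem_powersetCard] at he
        refine Finset.mem_image.2 ⟨e.erase v, Finset.mem_powersetCard.2
          ⟨Finset.subset_univ _, ?_⟩, Finset.insert_erase he.2⟩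
        rw [Finset.card_erase_of_mem he.2, he.1.2]
    _ ≤ _ := Finset.card_image_le
    _ = (Fintype.card V).choose 2 := by rw [Finset.card_powersetCard, Finset.card_univ]
    _ ≤ _ := Nat.choose_le_pow _ _

end RGraph

/-- There is a `3`-graph on `n` vertices with `p` components and at most `e` edges in which no set
of more than `a` vertices is independent. -/
def Attainable (n a p e : ℕ) : Prop :=
  ∃ H : RGraph 3 (Fin n), H.edges.card ≤ e ∧ H.numComponents = p ∧ H.Covers (a + 1)

theorem Attainable.add {n a p e n' a' p' e' : ℕ} (h : Attainable n a p e)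
    (h' : Attainable n' a' p' e') : Attainable (n + n') (a + a') (p + p') (e + e') := by
  obtain ⟨G, hG, hGp, hGa⟩ := h
  obtain ⟨H, hH, hHp, hHa⟩ := h'
  refine ⟨(G.sum H).comap finSumFinEquiv.symm.toEmbedding, ?_, ?_, ?_⟩
  · exact (RGraph.card_comap_edges_le _ _).trans
      ((RGraph.card_sum_edges_le _ _).trans (Nat.add_le_add hG hH))
  · rw [RGraph.numComponents_comap, RGraph.numComponents_sum, hGp, hHp]
  · exact (hGa.sum hHa).comap _

theorem attainable_zero : Attainable 0 0 0 0 := by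
  refine ⟨⟨∅, by simp⟩, by simp, ?_, ?_⟩
  · rw [RGraph.numComponents, Nat.card_eq_zero]
    left
    refine ⟨fun c => ?_⟩
    induction c using SimpleGraph.ConnectedComponent.ind with | _ x => exact x.elim0
  · intro S hS
    have := S.card_le_univ
    simp at this
    simp [this] at hS

theorem Attainable.nsmul {n a p e : ℕ} (h : Attainable n a p e) (q : ℕ) :
    Attainable (q * n) (q * a) (q * p) (q * e) := by
  induction q with
  | zero => simpa using attainable_zero
  | succ q ih => simpa [Nat.succ_mul] using ih.add h

theorem attainable_complete {n : ℕ} (hn : 3 ≤ n) : Attainable n 2 1 (n.choose 3) := by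
  refine ⟨RGraph.complete 3 _, ?_, ?_, RGraph.complete_covers le_rfl _⟩
  · rw [RGraph.card_complete_edges, Fintype.card_fin]
  · exact RGraph.numComponents_eq_one (by simpa using hn) ⟨0, by omega⟩
      fun e he _ => RGraph.mem_complete_edges.2 he

theorem attainable_dualTuran {n a : ℕ} (hn : 3 ≤ n) (ha : 2 ≤ a) :
    Attainable n a 1 (dualTuran n (a + 1) 3 + n ^ 2) := by
  obtain ⟨H, hH, hc⟩ := exists_card_eq_dualTuran (by omega : 3 ≤ a + 1) n
  refine ⟨H.addStar (⟨0, by omega⟩ : Fin n), ?_, ?_, ?_⟩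
  · rw [← hH]
    simpa using H.card_addStar_edges_le (⟨0, by omega⟩ : Fin n)
  · exact RGraph.numComponents_eq_one (by simpa using hn) (⟨0, by omega⟩ : Fin n)
      fun e he hv => RGraph.mem_addStar_edges.2 (Or.inr ⟨he, hv⟩)
  · intro S hS
    obtain ⟨e, he, heS⟩ := hc S hS
    exact ⟨e, RGraph.mem_addStar_edges.2 (Or.inl he), heS⟩

theorem Attainable.dualTuranComp_le {n a p e : ℕ} (h : Attainable n a p e) :
    dualTuranComp n (a + 1) 3 p ≤ e := by
  obtain ⟨H, hH, hp, hc⟩ := h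
  exact le_trans (Nat.sInf_le ⟨H, rfl, hp, hc⟩) hH

theorem Attainable.exists_card_eq_dualTuranComp {n a p e : ℕ} (h : Attainable n a p e) :
    ∃ H : RGraph 3 (Fin n), H.edges.card = dualTuranComp n (a + 1) 3 p ∧
      H.numComponents = p ∧ H.Covers (a + 1) := by
  obtain ⟨H, hH, hp, hc⟩ := h
  exact Nat.sInf_mem (s := {t : ℕ | ∃ H : RGraph 3 (Fin n),
    H.edges.card = t ∧ H.numComponents = p ∧ H.Covers (a + 1)}) ⟨_, H, rfl, hp, hc⟩

theorem attainable_cliques_add {n a m s : ℕ} (hs : 3 ≤ s) (ha : 2 ≤ a)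
    (hn : (m - 1) * s + 3 ≤ n) (hm : 1 ≤ m) :
    Attainable n (2 * (m - 1) + a) m ((m - 1) * s.choose 3 +
      (dualTuran (n - (m - 1) * s) (a + 1) 3 + (n - (m - 1) * s) ^ 2)) := by
  have h := ((attainable_complete hs).nsmul (m - 1)).add
    (attainable_dualTuran (n := n - (m - 1) * s) (by omega) ha)
  rwa [Nat.add_sub_cancel' (by omega), mul_one, Nat.sub_add_cancel hm, mul_comm (m - 1) 2] at h

/-- The sizes and the independence numbers of the components of a `3`-graph. -/
theorem RGraph.exists_component_sizes {n m k : ℕ} (H : RGraph 3 (Fin n))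
    (hm : H.numComponents = m) (hH : H.Covers k) :
    ∃ s α : Fin m → ℕ, ∑ i, s i = n ∧ (∀ i, 1 ≤ α i) ∧ (∀ i, α i = 1 → s i ≤ 1) ∧
      ∑ i, α i < k ∧ ∑ i, dualTuran (s i) (α i + 1) 3 ≤ H.edges.card := by
  classical
  let E : H.shadow.ConnectedComponent ≃ Fin m := Finite.equivFinOfCardEq hm
  let c : Fin n → Fin m := fun v => E (H.shadow.connectedComponentMk v)
  have hsurj : Function.Surjective c := by
    intro i
    obtain ⟨C, rfl⟩ := E.surjective i
    induction C using SimpleGraph.ConnectedComponent.ind with | _ v => exact ⟨v, rfl⟩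
  have hc : ∀ e ∈ H.edges, ∀ u ∈ e, ∀ v ∈ e, c u = c v := by
    intro e he u hu v hv
    by_cases huv : u = v
    · rw [huv]
    · have : H.shadow.Reachable u v := SimpleGraph.Adj.reachable ⟨huv, e, he, hu, hv⟩
      simp only [c, SimpleGraph.ConnectedComponent.sound this]
  let S : Fin m → Finset (Fin n) := fun i => Finset.univ.filter fun v => c v = i
  have hS : ∀ i v, v ∈ S i ↔ c v = i := fun i v => by simp [S]
  have hmax : ∀ i, ∃ I ⊆ S i, H.Indep I ∧ ∀ J ⊆ S i, H.Indep J → J.card ≤ I.card := by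
    intro i
    obtain ⟨I, hI, hmax⟩ := ((S i).powerset.filter H.Indep).exists_max_image Finset.card
      ⟨∅, Finset.mem_filter.2 ⟨Finset.empty_mem_powerset _, indep_of_card_lt (by simp)⟩⟩
    simp only [Finset.mem_filter, Finset.mem_powerset] at hI hmax
    exact ⟨I, hI.1, hI.2, fun J hJ hJ' => hmax J ⟨hJ, hJ'⟩⟩
  choose I hIS hI hImax using hmax
  refine ⟨fun i => (S i).card, fun i => (I i).card, ?_, ?_, ?_, ?_, ?_⟩
  · have := Finset.card_eq_sum_card_fiberwise (s := (Finset.univ : Finset (Fin n)))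
      (t := Finset.univ) (f := c) (fun _ _ => by simp)
    rw [Finset.card_univ, Fintype.card_fin] at this
    exact this.symm
  · intro i
    obtain ⟨v, hv⟩ := hsurj i
    simpa using hImax i {v} (by simpa [hS] using hv) (indep_of_card_lt (by simp))
  · intro i (hi : (I i).card = 1)
    show (S i).card ≤ 1
    by_contra! hlt
    obtain ⟨A, hA, hA2⟩ := Finset.exists_subset_card_eq hlt
    have := hImax i A hA (indep_of_card_lt (by omega))
    omega
  · have hdisj : ∀ i j, i ≠ j → Disjoint (I i) (I j) := by
      intro i j hij
      rw [Finset.disjoint_left]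
      intro v hi hj
      exact hij (((hS i v).1 (hIS i hi)).symm.trans ((hS j v).1 (hIS j hj)))
    rw [← Finset.card_biUnion (s := Finset.univ) (t := I) fun i _ j _ hij => hdisj i j hij]
    by_contra! hge
    obtain ⟨e, he, heU⟩ := hH.exists_subset hge
    obtain ⟨v, hv⟩ : e.Nonempty := Finset.card_pos.1 (by rw [H.uniform e he]; norm_num)
    refine hI (c v) e he fun u hu => ?_
    obtain ⟨j, -, huj⟩ := Finset.mem_biUnion.1 (heU hu)
    have : j = c v := ((hS j u).1 (hIS j huj)).symm.trans (hc e he u hu v hv)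
    exact this ▸ huj
  · calc ∑ i, dualTuran (S i).card ((I i).card + 1) 3
        ≤ ∑ i, (H.edges.filter (· ⊆ S i)).card := by
          refine Finset.sum_le_sum fun i _ => dualTuran_card_le H (S i) fun A hA hAc => ?_
          by_contra! hno
          have := hImax i A hA hno
          omega
      _ = (Finset.univ.biUnion fun i => H.edges.filter (· ⊆ S i)).card := by
          refine (Finset.card_biUnion fun i _ j _ hij => ?_).symm
          rw [Function.onFun, Finset.disjoint_left]
          intro e hi hj
          simp only [Finset.mem_filter] at hi hj
          obtain ⟨v, hv⟩ : e.Nonempty := Finset.card_pos.1 (by rw [H.uniform e hi.1]; norm_num)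
          exact hij (((hS i v).1 (hi.2 hv)).symm.trans ((hS j v).1 (hj.2 hv)))
      _ ≤ H.edges.card := by
          refine Finset.card_le_card fun e he => ?_
          simp only [Finset.mem_biUnion, Finset.mem_filter] at he
          exact he.choose_spec.2.1

/-- The quantity `t_{3,k}^{-1/2}`. -/
noncomputable def turanRoot (k : ℕ) : ℝ := turanLimit 3 k ^ (-(1 / 2) : ℝ)

theorem turanRoot_pos {k : ℕ} (hk : 3 ≤ k) : 0 < turanRoot k :=
  Real.rpow_pos_of_pos (turanLimit_three_pos hk) _

theorem turanRoot_sq {k : ℕ} (hk : 3 ≤ k) : turanRoot k ^ 2 = (turanLimit 3 k)⁻¹ := by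
  rw [turanRoot, ← Real.rpow_natCast, ← Real.rpow_mul (turanLimit_three_pos hk).le]
  norm_num [Real.rpow_neg_one]

theorem turanLimit_mul_turanRoot_sq {k : ℕ} (hk : 3 ≤ k) :
    turanLimit 3 k * turanRoot k ^ 2 = 1 := by
  rw [turanRoot_sq hk, mul_inv_cancel₀ (turanLimit_three_pos hk).ne']

theorem one_le_turanRoot {k : ℕ} (hk : 3 ≤ k) : 1 ≤ turanRoot k := by
  refine le_of_sq_le_sq ?_ (turanRoot_pos hk).le
  rw [turanRoot_sq hk, one_pow]
  exact (one_le_inv₀ (turanLimit_three_pos hk)).2 (turanLimit_le_one hk)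

theorem turanRoot_three : turanRoot 3 = 1 := by
  rw [turanRoot, turanLimit_three_three, Real.one_rpow]

theorem turanRoot_four_ge : 3 / 2 ≤ turanRoot 4 := by
  have h4 : 3 ≤ 4 := by norm_num
  refine le_of_sq_le_sq ?_ (turanRoot_pos h4).le
  rw [turanRoot_sq h4]
  calc ((3 : ℝ) / 2) ^ 2 = (4 / 9)⁻¹ := by norm_num
    _ ≤ _ := inv_anti₀ (turanLimit_three_pos h4) turanLimit_three_four_le

theorem turanRoot_succ_sq_le {α : ℕ} (hα : 2 ≤ α) :
    turanRoot (α + 1) ^ 2 ≤ (α : ℝ) * (α - 1) / 2 := by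
  have hk : 3 ≤ α + 1 := by omega
  have h := one_div_choose_le_turanLimit hk
  rw [Nat.add_sub_cancel] at h
  have hpos : (0 : ℝ) < α.choose 2 := by exact_mod_cast Nat.choose_pos hα
  rw [turanRoot_sq hk, ← Nat.cast_choose_two]
  calc (turanLimit 3 (α + 1))⁻¹ ≤ (1 / (α.choose 2 : ℝ))⁻¹ := inv_anti₀ (by positivity) h
    _ = _ := by simp

/-- The weight of a component with independence number `α`. -/
noncomputable def indepWeight (α : ℕ) : ℝ := if α = 1 then 0 else turanRoot (α + 1)

theorem indepWeight_le_sub_one {α : ℕ} (hα : 1 ≤ α) : indepWeight α ≤ (α : ℝ) - 1 := by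
  unfold indepWeight
  split_ifs with h
  · simp [h]
  · have h2 : 2 ≤ α := by omega
    have h2' : (2 : ℝ) ≤ α := by exact_mod_cast h2
    refine le_of_sq_le_sq ((turanRoot_succ_sq_le h2).trans ?_) (by linarith)
    nlinarith

theorem indepWeight_le_turanRoot_add {a α : ℕ} (ha : a = 2 ∨ a = 3) (hα : a ≤ α) :
    indepWeight α ≤ turanRoot (a + 1) + ((α : ℝ) - a) := by
  rcases ha with rfl | rfl
  · have := indepWeight_le_sub_one (by omega : 1 ≤ α)
    rw [turanRoot_three]
    push_cast
    linarith
  · rcases hα.eq_or_lt with rfl | hlt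
    · simp [indepWeight]
    · have h4 : (4 : ℝ) ≤ α := by exact_mod_cast hlt
      have h1 : turanRoot (α + 1) ≤ (α : ℝ) - 3 / 2 := by
        refine le_of_sq_le_sq ((turanRoot_succ_sq_le (by omega)).trans ?_) (by linarith)
        nlinarith
      have h2 := turanRoot_four_ge
      rw [indepWeight, if_neg (by omega)]
      push_cast
      linarith

theorem sum_indepWeight_le {m a : ℕ} (ha : a = 2 ∨ a = 3) (hm : 1 ≤ m) {α : Fin m → ℕ}
    (h1 : ∀ i, 1 ≤ α i) (hsum : ∑ i, α i ≤ 2 * (m - 1) + a) :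
    ∑ i, indepWeight (α i) ≤ (m : ℝ) - 1 + turanRoot (a + 1) := by
  have hroot : 1 ≤ turanRoot (a + 1) := one_le_turanRoot (by omega)
  have hsum' : ∑ i, (α i : ℝ) ≤ 2 * ((m : ℝ) - 1) + a := by
    have : ((∑ i, α i : ℕ) : ℝ) ≤ ((2 * (m - 1) + a : ℕ) : ℝ) := by exact_mod_cast hsum
    rw [Nat.cast_add, Nat.cast_mul, Nat.cast_sub hm] at this
    push_cast at this
    exact this
  by_cases hex : ∃ i, a ≤ α i
  · obtain ⟨i, hi⟩ := hex
    calc ∑ j, indepWeight (α j)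
        ≤ ∑ j, (((α j : ℝ) - 1) + if j = i then turanRoot (a + 1) + 1 - a else 0) := by
          refine Finset.sum_le_sum fun j _ => ?_
          split_ifs with hj
          · have := indepWeight_le_turanRoot_add ha hi
            rw [hj]
            linarith
          · rw [add_zero]
            exact indepWeight_le_sub_one (h1 j)
      _ = ∑ j, (α j : ℝ) - m + (turanRoot (a + 1) + 1 - a) := by
          rw [Finset.sum_add_distrib, Finset.sum_sub_distrib]
          simp
      _ ≤ _ := by linarith
  · push Not at hex
    calc ∑ j, indepWeight (α j) ≤ ∑ _j : Fin m, (1 : ℝ) := by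
          refine Finset.sum_le_sum fun j _ => (indepWeight_le_sub_one (h1 j)).trans ?_
          have : α j ≤ 2 := by have := hex j; omega
          have : (α j : ℝ) ≤ 2 := by exact_mod_cast this
          linarith
      _ = m := by simp
      _ ≤ _ := by linarith

/-- The tangent line bound for the number of edges of a component with `s` vertices and
independence number `α`. -/
theorem eventually_tangent_le {α : ℕ} (hα : 1 ≤ α) {ε : ℝ} (hε : 0 < ε) :
    ∀ᶠ N : ℕ in atTop, ∀ s ≤ N, (α = 1 → s ≤ 1) → ∀ l : ℝ, 0 ≤ l → l ≤ N →
      3 * l ^ 2 * s - 2 * l ^ 3 * indepWeight α - ε * (N : ℝ) ^ 3 ≤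
        6 * (dualTuran s (α + 1) 3 : ℝ) := by
  by_cases h : α = 1
  · obtain ⟨N₀, hN₀⟩ := exists_nat_ge (3 / ε)
    filter_upwards [eventually_ge_atTop N₀] with N hN s hs hs1 l hl hlN
    have h1 : (s : ℝ) ≤ 1 := by exact_mod_cast hs1 h
    have h2 : 3 / ε ≤ N := hN₀.trans (by exact_mod_cast hN)
    rw [div_le_iff₀ hε] at h2
    have h3 : l ^ 2 ≤ (N : ℝ) ^ 2 := pow_le_pow_left₀ hl hlN 2
    have h4 : 3 * (N : ℝ) ^ 2 ≤ N * ε * (N : ℝ) ^ 2 :=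
      mul_le_mul_of_nonneg_right h2 (by positivity)
    have h5 : 3 * l ^ 2 * s ≤ 3 * l ^ 2 * 1 := mul_le_mul_of_nonneg_left h1 (by positivity)
    have h6 : (0 : ℝ) ≤ 6 * (dualTuran s (α + 1) 3 : ℝ) := by positivity
    rw [indepWeight, if_pos h]
    nlinarith
  · have hk : 3 ≤ α + 1 := by omega
    filter_upwards [eventually_turanLimit_mul_le hk hε] with N hN s hs _ l hl _
    refine le_trans ?_ (hN s hs)
    rw [indepWeight, if_neg h]
    have ht := turanLimit_three_pos hk
    have hr := turanRoot_pos hk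
    have hq := turanLimit_mul_turanRoot_sq hk
    set t := turanLimit 3 (α + 1)
    set τ := turanRoot (α + 1)
    have h1 : 0 ≤ t * (((s : ℝ) - l * τ) ^ 2 * (s + 2 * (l * τ))) := by positivity
    have h2 : t * (((s : ℝ) - l * τ) ^ 2 * (s + 2 * (l * τ))) =
        t * (s : ℝ) ^ 3 - 3 * l ^ 2 * s * (t * τ ^ 2) + 2 * l ^ 3 * τ * (t * τ ^ 2) := by ring
    rw [h2, hq] at h1
    linarith

theorem eventually_le_six_mul_card {m a : ℕ} (ha : a = 2 ∨ a = 3) (hm : 1 ≤ m) {ε : ℝ}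
    (hε : 0 < ε) :
    ∀ᶠ n : ℕ in atTop, ∀ H : RGraph 3 (Fin n), H.numComponents = m →
      H.Covers (2 * (m - 1) + a + 1) →
      (n : ℝ) ^ 3 / ((m : ℝ) - 1 + turanRoot (a + 1)) ^ 2 - m * (ε * (n : ℝ) ^ 3) ≤
        6 * (H.edges.card : ℝ) := by
  have hev : ∀ᶠ n : ℕ in atTop, ∀ α ∈ Finset.Icc 1 (2 * (m - 1) + a), ∀ s ≤ n,
      (α = 1 → s ≤ 1) → ∀ l : ℝ, 0 ≤ l → l ≤ n →
      3 * l ^ 2 * s - 2 * l ^ 3 * indepWeight α - ε * (n : ℝ) ^ 3 ≤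
        6 * (dualTuran s (α + 1) 3 : ℝ) :=
    (Filter.eventually_all_finset _).2 fun α hα =>
      eventually_tangent_le (Finset.mem_Icc.1 hα).1 hε
  filter_upwards [hev] with n hn H hHm hH
  obtain ⟨s, α, hs, hα, hα1, hsum, hE⟩ := H.exists_component_sizes hHm hH
  have hroot : 1 ≤ turanRoot (a + 1) := one_le_turanRoot (by omega)
  have hw := sum_indepWeight_le ha hm hα (by omega)
  have hm' : (1 : ℝ) ≤ m := by exact_mod_cast hm
  set F := (m : ℝ) - 1 + turanRoot (a + 1)
  have hF : 1 ≤ F := by simp only [F]; linarith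
  have hl0 : 0 ≤ (n : ℝ) / F := by positivity
  have hln : (n : ℝ) / F ≤ n := div_le_self n.cast_nonneg hF
  have key : ∑ i, (3 * ((n : ℝ) / F) ^ 2 * s i - 2 * ((n : ℝ) / F) ^ 3 * indepWeight (α i) -
      ε * (n : ℝ) ^ 3) ≤ ∑ i, 6 * (dualTuran (s i) (α i + 1) 3 : ℝ) := by
    refine Finset.sum_le_sum fun i _ => hn (α i) (Finset.mem_Icc.2 ⟨hα i, ?_⟩) (s i) ?_ (hα1 i)
      _ hl0 hln
    · have := Finset.single_le_sum (f := α) (fun j _ => Nat.zero_le _) (Finset.mem_univ i)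
      omega
    · rw [← hs]
      exact Finset.single_le_sum (f := s) (fun j _ => Nat.zero_le _) (Finset.mem_univ i)
  have hs' : ∑ i, (s i : ℝ) = n := by exact_mod_cast hs
  rw [Finset.sum_sub_distrib, Finset.sum_sub_distrib, Finset.sum_const, Finset.card_univ,
    Fintype.card_fin, nsmul_eq_mul, ← Finset.mul_sum, ← Finset.mul_sum, ← Finset.mul_sum,
    hs'] at key
  have hE' : ∑ i, (dualTuran (s i) (α i + 1) 3 : ℝ) ≤ H.edges.card := by exact_mod_cast hE
  have h2 : 2 * ((n : ℝ) / F) ^ 3 * ∑ i, indepWeight (α i) ≤ 2 * ((n : ℝ) / F) ^ 3 * F :=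
    mul_le_mul_of_nonneg_left hw (by positivity)
  have h3 : 3 * ((n : ℝ) / F) ^ 2 * n - 2 * ((n : ℝ) / F) ^ 3 * F = (n : ℝ) ^ 3 / F ^ 2 := by
    field_simp
    ring
  linarith

theorem eventually_attainable {m a : ℕ} (ha : 2 ≤ a) (hm : 1 ≤ m) :
    ∀ᶠ n : ℕ in atTop, ∃ e, Attainable n (2 * (m - 1) + a) m e ∧
      6 * (e : ℝ) ≤ ((m : ℝ) - 1) * ((n : ℝ) / ((m : ℝ) - 1 + turanRoot (a + 1))) ^ 3 +
        turanLimit 3 (a + 1) * (turanRoot (a + 1) *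
          ((n : ℝ) / ((m : ℝ) - 1 + turanRoot (a + 1))) + ((m : ℝ) - 1)) ^ 3 +
        6 * (n : ℝ) ^ 2 := by
  have hk : 3 ≤ a + 1 := by omega
  have hroot : 1 ≤ turanRoot (a + 1) := one_le_turanRoot hk
  have ht := turanLimit_three_pos hk
  have hm' : (1 : ℝ) ≤ m := by exact_mod_cast hm
  set τ := turanRoot (a + 1)
  set F := (m : ℝ) - 1 + τ with hFdef
  have hF : 0 < F := by linarith
  obtain ⟨n₀, hn₀⟩ := exists_nat_ge (3 * F)
  filter_upwards [eventually_ge_atTop n₀] with n hn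
  have hnF : 3 ≤ (n : ℝ) / F := by
    rw [le_div_iff₀ hF]
    exact hn₀.trans (by exact_mod_cast hn)
  have hx0 : 0 ≤ (n : ℝ) / F := by linarith
  have hnx : (n : ℝ) = ((m : ℝ) - 1) * ((n : ℝ) / F) + τ * ((n : ℝ) / F) := by
    rw [← add_mul, ← hFdef]
    field_simp
  set x := (n : ℝ) / F
  set s := ⌊x⌋₊
  have hs3 : 3 ≤ s := Nat.le_floor (by exact_mod_cast hnF)
  have hsx : (s : ℝ) ≤ x := Nat.floor_le hx0
  have hsx' : x ≤ (s : ℝ) + 1 := (Nat.lt_floor_add_one x).le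
  have hcast : (((m - 1) * s : ℕ) : ℝ) = ((m : ℝ) - 1) * s := by
    rw [Nat.cast_mul, Nat.cast_sub hm]
    simp
  have hms : ((m : ℝ) - 1) * s ≤ ((m : ℝ) - 1) * x :=
    mul_le_mul_of_nonneg_left hsx (by linarith)
  have hms' : ((m : ℝ) - 1) * x ≤ ((m : ℝ) - 1) * (s + 1) :=
    mul_le_mul_of_nonneg_left hsx' (by linarith)
  have hle : (m - 1) * s + 3 ≤ n := by
    have : (((m - 1) * s : ℕ) : ℝ) + 3 ≤ n := by
      rw [hcast]
      nlinarith
    exact_mod_cast this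
  refine ⟨_, attainable_cliques_add hs3 ha hle hm, ?_⟩
  set r := n - (m - 1) * s with hr
  have hrcast : (r : ℝ) = n - ((m : ℝ) - 1) * s := by
    rw [hr, Nat.cast_sub (by omega), hcast]
  have hrx : (r : ℝ) ≤ τ * x + ((m : ℝ) - 1) := by linarith
  have hrn : (r : ℝ) ≤ n := by exact_mod_cast Nat.sub_le _ _
  have e1 : ((m : ℝ) - 1) * (6 * (s.choose 3 : ℝ)) ≤ ((m : ℝ) - 1) * x ^ 3 :=
    mul_le_mul_of_nonneg_left ((six_mul_choose_three_le s).trans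
      (pow_le_pow_left₀ s.cast_nonneg hsx 3)) (by linarith)
  have e2 : 6 * (dualTuran r (a + 1) 3 : ℝ) ≤
      turanLimit 3 (a + 1) * (τ * x + ((m : ℝ) - 1)) ^ 3 := by
    calc 6 * (dualTuran r (a + 1) 3 : ℝ) ≤ 6 * (turanLimit 3 (a + 1) * r.choose 3) :=
          mul_le_mul_of_nonneg_left (dualTuran_le_turanLimit_mul hk r) (by norm_num)
      _ = turanLimit 3 (a + 1) * (6 * (r.choose 3 : ℝ)) := by ring
      _ ≤ _ := mul_le_mul_of_nonneg_left ((six_mul_choose_three_le r).trans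
          (pow_le_pow_left₀ r.cast_nonneg hrx 3)) ht.le
  have e3 : 6 * (r : ℝ) ^ 2 ≤ 6 * (n : ℝ) ^ 2 :=
    mul_le_mul_of_nonneg_left (pow_le_pow_left₀ r.cast_nonneg hrn 2) (by norm_num)
  have hm1 : ((m - 1 : ℕ) : ℝ) = (m : ℝ) - 1 := by rw [Nat.cast_sub hm]; simp
  push_cast
  rw [hm1]
  linarith

theorem tendsto_cube_div_six_mul_choose_three :
    Tendsto (fun n : ℕ => (n : ℝ) ^ 3 / (6 * (n.choose 3 : ℝ))) atTop (𝓝 1) := by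
  have h1 : Tendsto (fun n : ℕ => (1 - 1 / (n : ℝ)) * (1 - 2 / (n : ℝ))) atTop (𝓝 1) := by
    have h := ((tendsto_const_nhds (x := (1 : ℝ))).sub
      (tendsto_const_div_atTop_nhds_zero_nat (1 : ℝ))).mul
      ((tendsto_const_nhds (x := (1 : ℝ))).sub (tendsto_const_div_atTop_nhds_zero_nat (2 : ℝ)))
    simpa using h
  have h2 := h1.inv₀ one_ne_zero
  rw [inv_one] at h2
  refine h2.congr' ?_
  filter_upwards [eventually_ge_atTop 3] with n hn
  have hn' : (3 : ℝ) ≤ n := by exact_mod_cast hn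
  have e1 : (n : ℝ) ≠ 0 := by positivity
  rw [six_mul_choose_three, show (1 - 1 / (n : ℝ)) * (1 - 2 / (n : ℝ)) =
    (n * ((n : ℝ) - 1) * ((n : ℝ) - 2)) / (n : ℝ) ^ 3 by field_simp, inv_div]

theorem tendsto_dualTuranCompRatio {m a : ℕ} (ha : a = 2 ∨ a = 3) (hm : 1 ≤ m) :
    Tendsto (dualTuranCompRatio 3 (2 * (m - 1) + a + 1) m) atTop
      (𝓝 (1 / ((m : ℝ) - 1 + turanRoot (a + 1)) ^ 2)) := by
  have hk : 3 ≤ a + 1 := by omega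
  have ha2 : 2 ≤ a := by omega
  have hroot : 1 ≤ turanRoot (a + 1) := one_le_turanRoot hk
  have hq := turanLimit_mul_turanRoot_sq hk
  have hm' : (1 : ℝ) ≤ m := by exact_mod_cast hm
  have hatt := eventually_attainable ha2 hm
  have hlow := fun ε hε => eventually_le_six_mul_card ha hm (ε := ε) hε
  set τ := turanRoot (a + 1)
  set t := turanLimit 3 (a + 1)
  set F := (m : ℝ) - 1 + τ with hFdef
  have hF : 0 < F := by linarith
  let u : ℕ → ℝ := fun n => 6 * (dualTuranComp n (2 * (m - 1) + a + 1) 3 m : ℝ) / (n : ℝ) ^ 3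
  have hu : Tendsto u atTop (𝓝 (1 / F ^ 2)) := by
    refine tendsto_order.2 ⟨fun l hl => ?_, fun l hl => ?_⟩
    · obtain ⟨ε, hε, hεl⟩ : ∃ ε : ℝ, 0 < ε ∧ l < 1 / F ^ 2 - m * ε := by
        refine ⟨(1 / F ^ 2 - l) / (2 * m), div_pos (by linarith) (by positivity), ?_⟩
        have : (m : ℝ) * ((1 / F ^ 2 - l) / (2 * m)) = (1 / F ^ 2 - l) / 2 := by
          field_simp
        rw [this]
        linarith
      filter_upwards [hlow ε hε, hatt, eventually_gt_atTop 0] with n h1 ⟨e, he, _⟩ hn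
      obtain ⟨H, hH, hHm, hHc⟩ := he.exists_card_eq_dualTuranComp
      have h2 := h1 H hHm hHc
      rw [hH] at h2
      have hn' : (0 : ℝ) < (n : ℝ) ^ 3 := by positivity
      refine hεl.trans_le ((le_div_iff₀ hn').2 (le_trans (le_of_eq ?_) h2))
      field_simp
    · have hlim : Tendsto (fun n : ℕ => ((m : ℝ) - 1) * (1 / F) ^ 3 +
          t * (τ * (1 / F) + ((m : ℝ) - 1) / n) ^ 3 + 6 / (n : ℝ)) atTop
          (𝓝 (((m : ℝ) - 1) * (1 / F) ^ 3 + t * (τ * (1 / F) + 0) ^ 3 + 0)) :=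
        (tendsto_const_nhds.add (tendsto_const_nhds.mul ((tendsto_const_nhds.add
          (tendsto_const_div_atTop_nhds_zero_nat _)).pow 3))).add
          (tendsto_const_div_atTop_nhds_zero_nat _)
      have hval : ((m : ℝ) - 1) * (1 / F) ^ 3 + t * (τ * (1 / F) + 0) ^ 3 + 0 = 1 / F ^ 2 := by
        have : ((m : ℝ) - 1) * (1 / F) ^ 3 + t * (τ * (1 / F) + 0) ^ 3 + 0 =
          (((m : ℝ) - 1) + (t * τ ^ 2) * τ) * (1 / F) ^ 3 := by ring
        rw [this, hq, one_mul, ← hFdef]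
        field_simp
      rw [hval] at hlim
      filter_upwards [hlim.eventually (gt_mem_nhds hl), hatt, eventually_gt_atTop 0]
        with n h1 ⟨e, he, hle⟩ hn
      have hn0 : (0 : ℝ) < n := by exact_mod_cast hn
      have hn' : (0 : ℝ) < (n : ℝ) ^ 3 := by positivity
      refine lt_of_le_of_lt ((div_le_iff₀ hn').2 ?_) h1
      have h2 : 6 * (dualTuranComp n (2 * (m - 1) + a + 1) 3 m : ℝ) ≤ 6 * (e : ℝ) :=
        mul_le_mul_of_nonneg_left (by exact_mod_cast he.dualTuranComp_le) (by norm_num)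
      refine (h2.trans hle).trans (le_of_eq ?_)
      field_simp
  have h := hu.mul tendsto_cube_div_six_mul_choose_three
  rw [mul_one] at h
  refine h.congr' ?_
  filter_upwards [eventually_ge_atTop 3] with n hn
  have h1 : (n : ℝ) ≠ 0 := by
    have : n ≠ 0 := by omega
    exact_mod_cast this
  have h2 : (n.choose 3 : ℝ) ≠ 0 := by exact_mod_cast (Nat.choose_pos hn).ne'
  simp only [u, dualTuranCompRatio]
  field_simp

theorem theorem3 :
    -- the limit `t_{3,4}` exists and is positive
    Tendsto (dualTuranRatio 3 4) atTop (𝓝 (turanLimit 3 4)) ∧ 0 < turanLimit 3 4 ∧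
    ∀ m : ℕ, 1 ≤ m →
      -- the limits `t_{3,2m+1}(m)` and `t_{3,2m+2}(m)` exist
      Tendsto (dualTuranCompRatio 3 (2 * m + 1) m) atTop
        (𝓝 (turanCompLimit 3 (2 * m + 1) m)) ∧
      Tendsto (dualTuranCompRatio 3 (2 * m + 2) m) atTop
        (𝓝 (turanCompLimit 3 (2 * m + 2) m)) ∧
      -- and have the following values
      turanCompLimit 3 (2 * m + 1) m = 1 / (m : ℝ) ^ 2 ∧
      turanCompLimit 3 (2 * m + 2) m =
        ((m : ℝ) - 1 + turanLimit 3 4 ^ (-(1 / 2) : ℝ)) ^ (-2 : ℤ) := by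
  refine ⟨tendsto_dualTuranRatio (by norm_num), turanLimit_three_pos (by norm_num),
    fun m hm => ?_⟩
  have h2 := tendsto_dualTuranCompRatio (a := 2) (Or.inl rfl) hm
  have h3 := tendsto_dualTuranCompRatio (a := 3) (Or.inr rfl) hm
  rw [show 2 * (m - 1) + 2 + 1 = 2 * m + 1 by omega, turanRoot_three, sub_add_cancel] at h2
  rw [show 2 * (m - 1) + 3 + 1 = 2 * m + 2 by omega] at h3
  have e2 : turanCompLimit 3 (2 * m + 1) m = _ := h2.limUnder_eq
  have e3 : turanCompLimit 3 (2 * m + 2) m = _ := h3.limUnder_eq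
  refine ⟨e2 ▸ h2, e3 ▸ h3, e2, e3.trans ?_⟩
  rw [turanRoot, zpow_neg, one_div]
  rfl
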